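/- Let $X$ be a real Banach space with $\dim X\ge 2$ and unit sphere $S_X$. For nonzero $u,v\in X$ define the P-angle $$\operatorname{ang}_P(u,v)=\arccos\left(\frac{\|u\|^2+\|v\|^2-\|u-v\|^2}{2\|u\|\,\|v\|}\right),$$ and put $$S_P(X)=\sup\{\cos\operatorname{ang}_P(x+y,x-y): x,y\in S_X,\ x\ne\pm y\},\qquad J(X)=\sup\{\min\{\|x+y\|,\|x-y\|\}: x,y\in S_X\}.$$ If $S_P(X)<\frac{3-\sqrt5}{4}$, then $J(X)<\frac{1+\sqrt5}{2}$, and $X$ has uniform normal structure, that is, $$\inf_A\frac{\operatorname{diam}A}{r(A)}>1,\qquad r(A)=\inf_{y\in A}\,\sup_{x\in A}\|x-y\|,$$ where $A$ runs over the bounded closed convex subsets of $X$ with $\operatorname{diam}A>0$. -/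

import Mathlib

namespace BanachGeometry

noncomputable section

/-- The P-angle between two (nonzero) vectors of a real normed space:
`arccos ((‖x‖² + ‖y‖² - ‖x - y‖²) / (2 ‖x‖ ‖y‖))`. -/
def pAngle {X : Type*} [NormedAddCommGroup X] (x y : X) : ℝ :=
  Real.arccos ((‖x‖ ^ 2 + ‖y‖ ^ 2 - ‖x - y‖ ^ 2) / (2 * ‖x‖ * ‖y‖))

/-- The P-angle constant `S_P(X)`: the supremum of `cos ang_P(x + y, x - y)` over all
unit vectors `x ≠ ± y`. The set is bounded by `1`, and it is nonempty when `dim X ≥ 2`. -/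
def pAngleConst (X : Type*) [NormedAddCommGroup X] : ℝ :=
  sSup {c : ℝ | ∃ x y : X, ‖x‖ = 1 ∧ ‖y‖ = 1 ∧ x ≠ y ∧ x ≠ -y ∧
    c = Real.cos (pAngle (x + y) (x - y))}

/-- The James constant `J(X)`: the supremum of `min (‖x + y‖, ‖x - y‖)` over unit vectors. -/
def jamesConst (X : Type*) [NormedAddCommGroup X] : ℝ :=
  sSup {c : ℝ | ∃ x y : X, ‖x‖ = 1 ∧ ‖y‖ = 1 ∧ c = min ‖x + y‖ ‖x - y‖}

/-- The Chebyshev radius of `A` relative to `A` itself (`A` bounded and nonempty):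
`inf_{y ∈ A} sup_{x ∈ A} ‖x - y‖`. -/
def chebyshevRadius {X : Type*} [NormedAddCommGroup X] (A : Set X) : ℝ :=
  ⨅ y : A, ⨆ x : A, ‖(x : X) - (y : X)‖

/-- `X` has uniform normal structure: the infimum of `diam A / r(A)`, over all bounded closed
convex sets `A ⊆ X` with `diam A > 0`, is greater than `1`. For such `A` one has
`0 < diam A ≤ 2 r(A)`, so the quotients are genuine; such sets exist when `X ≠ 0`. -/
def HasUniformNormalStructure (X : Type*) [NormedAddCommGroup X] [NormedSpace ℝ X] : Prop :=
  1 < sInf {q : ℝ | ∃ A : Set X, Bornology.IsBounded A ∧ IsClosed A ∧ Convex ℝ A ∧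
    0 < Metric.diam A ∧ q = Metric.diam A / chebyshevRadius A}

end

end BanachGeometry

namespace BanachGeometry

section SphereInequality

variable {X : Type*} [NormedAddCommGroup X] [NormedSpace ℝ X]

/-! For unit `x`, `y` put `a = ‖x + y‖`, `b = ‖x - y‖`. A bound `c` on the constant says `a² + b² -
4 ≤ 2cab`. If both `a` and `b` are large this fails, which bounds `J(X)`. If `a` tends to 2 it
forces `b ≤ 4c` in the limit, and `4c < 1`: the modulus of convexity is positive at some `ε < 1`.
Uniform normal structure follows from this directly, without the bound on `J(X)`: the midpoint of a
nearly diametral pair is a good centre. -/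

theorem cos_pAngle_add_sub {x y : X} (hx : ‖x‖ = 1) (hy : ‖y‖ = 1) (hxy : x ≠ y)
    (hxy' : x ≠ -y) :
    Real.cos (pAngle (x + y) (x - y)) =
      (‖x + y‖ ^ 2 + ‖x - y‖ ^ 2 - 4) / (2 * ‖x + y‖ * ‖x - y‖) := by
  have ha : 0 < ‖x + y‖ := norm_pos_iff.2 fun h => hxy' (eq_neg_of_add_eq_zero_left h)
  have hb : 0 < ‖x - y‖ := norm_pos_iff.2 (sub_ne_zero.2 hxy)
  have h2y : ‖(x + y) - (x - y)‖ = 2 := by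
    rw [show (x + y) - (x - y) = (2 : ℝ) • y by rw [two_smul]; abel, norm_smul, hy]
    norm_num
  have h2x : ‖(x + y) + (x - y)‖ = 2 := by
    rw [show (x + y) + (x - y) = (2 : ℝ) • x by rw [two_smul]; abel, norm_smul, hx]
    norm_num
  have h1 : 2 ≤ ‖x + y‖ + ‖x - y‖ := h2x ▸ norm_add_le _ _
  have h2 : ‖x + y‖ - ‖x - y‖ ≤ 2 := h2y ▸ norm_sub_norm_le _ _
  have h3 : ‖x - y‖ - ‖x + y‖ ≤ 2 := by
    have := norm_sub_norm_le (x - y) (x + y)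
    rwa [norm_sub_rev (x - y), h2y] at this
  have hden : 0 < 2 * ‖x + y‖ * ‖x - y‖ := by positivity
  -- `cos (arccos t) = t` needs `|t| ≤ 1`: the triangle inequalities for sides `a`, `b`, 2.
  rw [pAngle, h2y, Real.cos_arccos]
  · norm_num
  · rw [le_div_iff₀ hden]
    nlinarith
  · rw [div_le_one hden]
    nlinarith

/-- A bound on the P-angle constant, written as a quadratic inequality on the unit sphere. -/
theorem sq_norm_add_add_sq_norm_sub_le {c : ℝ} (hc : pAngleConst X ≤ c) {x y : X}
    (hx : ‖x‖ = 1) (hy : ‖y‖ = 1) :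
    ‖x + y‖ ^ 2 + ‖x - y‖ ^ 2 - 4 ≤ c * (2 * ‖x + y‖ * ‖x - y‖) := by
  have key (z : X) (hz : ‖z‖ = 1) : ‖z + z‖ = 2 := by
    rw [← two_smul ℝ z, norm_smul, hz]
    norm_num
  by_cases hxy : x = y
  · subst hxy
    rw [key x hx]
    norm_num
  by_cases hxy' : x = -y
  · subst hxy'
    rw [← neg_add', norm_neg, key y hy]
    norm_num
  have ha : 0 < ‖x + y‖ := norm_pos_iff.2 fun h => hxy' (eq_neg_of_add_eq_zero_left h)
  have hb : 0 < ‖x - y‖ := norm_pos_iff.2 (sub_ne_zero.2 hxy)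
  have hle : Real.cos (pAngle (x + y) (x - y)) ≤ c := by
    refine le_trans ?_ hc
    refine le_csSup ⟨1, ?_⟩ ⟨x, y, hx, hy, hxy, hxy', rfl⟩
    rintro _ ⟨u, v, -, -, -, -, rfl⟩
    exact Real.cos_le_one _
  rwa [cos_pAngle_add_sub hx hy hxy hxy', div_le_iff₀ (by positivity)] at hle

theorem jamesConst_le [Nontrivial X] (hc : pAngleConst X ≤ 191 / 1000) :
    jamesConst X ≤ 8 / 5 := by
  obtain ⟨e, he⟩ := exists_norm_eq X zero_le_one
  refine csSup_le ⟨_, e, e, he, he, rfl⟩ ?_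
  rintro _ ⟨x, y, hx, hy, rfl⟩
  by_contra! h
  obtain ⟨ha, hb⟩ := lt_min_iff.1 h
  have := sq_norm_add_add_sq_norm_sub_le hc hx hy
  -- `(a - b)² + 1.618ab ≤ 4` contradicts `ab > 2.56`.
  nlinarith [sq_nonneg (‖x + y‖ - ‖x - y‖), mul_pos (sub_pos.2 ha) (sub_pos.2 hb)]

theorem norm_inv_norm_smul_sub_self {p : X} (hp : p ≠ 0) :
    ‖‖p‖⁻¹ • p - p‖ = |1 - ‖p‖| := by
  have h : ‖p‖ ≠ 0 := norm_ne_zero_iff.2 hp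
  rw [show ‖p‖⁻¹ • p - p = (‖p‖⁻¹ - 1) • p by rw [sub_smul, one_smul], norm_smul,
    Real.norm_eq_abs, ← abs_norm p, ← abs_mul, abs_norm, sub_mul, one_mul, inv_mul_cancel₀ h]

/-- A small P-angle constant forces the modulus of convexity to be positive at `9 / 10`. -/
theorem norm_add_le_of_le_norm_sub (hc : pAngleConst X ≤ 191 / 1000) {p q : X}
    (hp : ‖p‖ ≤ 1) (hq : ‖q‖ ≤ 1) (hpq : 9 / 10 ≤ ‖p - q‖) :
    ‖p + q‖ ≤ 2 * (999 / 1000) := by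
  by_contra! h
  have hpq' := norm_add_le p q
  have hp0 : p ≠ 0 := norm_pos_iff.1 (by linarith)
  have hq0 : q ≠ 0 := norm_pos_iff.1 (by linarith)
  have hdp := norm_inv_norm_smul_sub_self hp0
  have hdq := norm_inv_norm_smul_sub_self hq0
  rw [abs_of_nonneg (by linarith)] at hdp hdq
  have hx := norm_smul_inv_norm (𝕜 := ℝ) hp0
  have hy := norm_smul_inv_norm (𝕜 := ℝ) hq0
  simp only [RCLike.ofReal_real_eq_id, id] at hx hy
  set x := ‖p‖⁻¹ • p
  set y := ‖q‖⁻¹ • q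
  have hmain := sq_norm_add_add_sq_norm_sub_le hc hx hy
  have ha : ‖p + q‖ - ‖x + y‖ ≤ ‖x - p‖ + ‖y - q‖ := by
    refine (norm_sub_norm_le _ _).trans ?_
    rw [norm_sub_rev, add_sub_add_comm]
    exact norm_add_le _ _
  have hb : ‖p - q‖ - ‖x - y‖ ≤ ‖x - p‖ + ‖y - q‖ := by
    refine (norm_sub_norm_le _ _).trans ?_
    rw [norm_sub_rev, sub_sub_sub_comm]
    exact norm_sub_le _ _
  have ha2 : ‖x + y‖ ≤ 2 := (norm_add_le _ _).trans (by linarith)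
  have ha1 : 1996 / 1000 ≤ ‖x + y‖ := by linarith
  have hb1 : 89 / 100 ≤ ‖x - y‖ := by linarith
  -- Now `b² - 0.764b ≤ 4 - 1.996² < 0.016`, false for `b ≥ 0.89`.
  have hab : ‖x + y‖ * ‖x - y‖ ≤ 2 * ‖x - y‖ :=
    mul_le_mul_of_nonneg_right ha2 (norm_nonneg _)
  nlinarith

end SphereInequality

section NormalStructure

variable {X : Type*} [NormedAddCommGroup X]

theorem bddAbove_range_norm_sub {A : Set X} (hA : Bornology.IsBounded A) (y : A) :
    BddAbove (Set.range fun x : A => ‖(x : X) - (y : X)‖) := by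
  refine ⟨Metric.diam A, ?_⟩
  rintro _ ⟨x, rfl⟩
  simpa only [← dist_eq_norm] using Metric.dist_le_diam_of_mem hA x.2 y.2

theorem nonempty_of_diam_pos {A : Set X} (hA : 0 < Metric.diam A) : A.Nonempty := by
  by_contra h
  rw [Set.not_nonempty_iff_eq_empty.1 h, Metric.diam_empty] at hA
  exact hA.false

theorem diam_le_two_mul_chebyshevRadius {A : Set X} (hA : Bornology.IsBounded A)
    (hd : 0 < Metric.diam A) : Metric.diam A ≤ 2 * chebyshevRadius A := by
  have : Nonempty A := (nonempty_of_diam_pos hd).to_subtype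
  suffices h : Metric.diam A / 2 ≤ chebyshevRadius A by linarith
  refine le_ciInf fun z => ?_
  have hz (x : A) : dist (x : X) z ≤ ⨆ x : A, ‖(x : X) - (z : X)‖ := by
    rw [dist_eq_norm]
    exact le_ciSup (bddAbove_range_norm_sub hA z) x
  have h0 : 0 ≤ ⨆ x : A, ‖(x : X) - (z : X)‖ := Real.iSup_nonneg fun _ => norm_nonneg _
  have := Metric.diam_le_of_forall_dist_le (s := A) (add_nonneg h0 h0) fun x hx y hy =>
    (dist_triangle_right x y z).trans (add_le_add (hz ⟨x, hx⟩) (hz ⟨y, hy⟩))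
  linarith

theorem chebyshevRadius_le {A : Set X} {z : X} (hz : z ∈ A) {R : ℝ}
    (h : ∀ w ∈ A, ‖w - z‖ ≤ R) : chebyshevRadius A ≤ R := by
  have : Nonempty A := ⟨⟨z, hz⟩⟩
  refine (ciInf_le ⟨0, ?_⟩ (⟨z, hz⟩ : A)).trans (ciSup_le fun w => h w w.2)
  rintro _ ⟨y, rfl⟩
  exact Real.iSup_nonneg fun _ => norm_nonneg _

variable [NormedSpace ℝ X]

/-- If the modulus of convexity of `X` is positive at some `ε < 1`, midpoints of nearly diametral
pairs show that `X` has uniform normal structure. -/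
theorem hasUniformNormalStructure_of_modulus [Nontrivial X] {ε θ : ℝ} (hε : ε < 1) (hε0 : 0 ≤ ε)
    (hθ0 : 0 < θ) (hθ : θ < 1)
    (hX : ∀ p q : X, ‖p‖ ≤ 1 → ‖q‖ ≤ 1 → ε ≤ ‖p - q‖ → ‖p + q‖ ≤ 2 * θ) :
    HasUniformNormalStructure X := by
  -- The infimum is at least `θ⁻¹`; the unit ball shows that the family is nonempty.
  refine (one_lt_inv₀ hθ0).2 hθ |>.trans_le (le_csInf ?_ ?_)
  · obtain ⟨e, he⟩ := exists_norm_eq X zero_le_one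
    refine ⟨_, Metric.closedBall 0 1, Metric.isBounded_closedBall, Metric.isClosed_closedBall,
      convex_closedBall 0 1, ?_, rfl⟩
    refine lt_of_lt_of_le ?_ (Metric.dist_le_diam_of_mem Metric.isBounded_closedBall
      (show e ∈ Metric.closedBall (0 : X) 1 by simp [he])
      (show (0 : X) ∈ Metric.closedBall (0 : X) 1 by simp))
    simp [he]
  rintro _ ⟨A, hb, -, hconv, hd, rfl⟩
  have hr : 0 < chebyshevRadius A := by
    linarith [diam_le_two_mul_chebyshevRadius hb hd]
  set d := Metric.diam A with hd_def
  obtain ⟨x, hx, y, hy, hxy⟩ : ∃ x ∈ A, ∃ y ∈ A, ε * d < dist x y := by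
    by_contra! h
    have := Metric.diam_le_of_forall_dist_le (mul_nonneg hε0 hd.le) h
    nlinarith
  have hscale (v : X) : ‖d⁻¹ • v‖ = ‖v‖ / d := by
    rw [norm_smul, norm_inv, Real.norm_of_nonneg hd.le, div_eq_inv_mul]
  have hle {u v : X} (hu : u ∈ A) (hv : v ∈ A) : ‖d⁻¹ • (u - v)‖ ≤ 1 := by
    rw [hscale, div_le_one hd, ← dist_eq_norm]
    exact Metric.dist_le_diam_of_mem hb hu hv
  have hrad : chebyshevRadius A ≤ θ * d := by
    refine chebyshevRadius_le (hconv.midpoint_mem hx hy) fun w hw => ?_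
    -- `(w - x)/d` and `(w - y)/d` lie in the unit ball, more than `ε` apart; their sum is `2/d`
    -- times `w` minus the midpoint.
    have h := hX _ _ (hle hw hx) (hle hw hy) (by
      rw [← smul_sub, sub_sub_sub_cancel_left, hscale, le_div_iff₀ hd, norm_sub_rev,
        ← dist_eq_norm]
      exact hxy.le)
    have hmid : (w - x) + (w - y) = (2 : ℝ) • (w - midpoint ℝ x y) := by
      rw [midpoint_eq_smul_add, smul_sub, smul_smul, two_smul]
      norm_num
      abel
    rw [← smul_add, hscale, hmid, norm_smul, div_le_iff₀ hd] at h
    norm_num at h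
    linarith
  rw [le_div_iff₀ hr, inv_mul_le_iff₀ hθ0]
  exact hrad

end NormalStructure

end BanachGeometry

theorem theorem5p4 {X : Type*} [NormedAddCommGroup X] [NormedSpace ℝ X] [CompleteSpace X]
    (hdim : 2 ≤ Module.rank ℝ X)
    (hS : BanachGeometry.pAngleConst X < (3 - Real.sqrt 5) / 4) :
    BanachGeometry.jamesConst X < (1 + Real.sqrt 5) / 2 ∧
      BanachGeometry.HasUniformNormalStructure X := by
  have : Nontrivial X := rank_pos_iff_nontrivial.1 (lt_of_lt_of_le two_pos hdim)
  -- `(3 - 2.236)/4 = 0.191` and `8/5 < (1 + 2.236)/2`.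
  have h5 : (2236 / 1000 : ℝ) ≤ √5 := Real.le_sqrt_of_sq_le (by norm_num)
  have hc : BanachGeometry.pAngleConst X ≤ 191 / 1000 := by linarith
  refine ⟨by linarith [BanachGeometry.jamesConst_le hc], ?_⟩
  exact BanachGeometry.hasUniformNormalStructure_of_modulus (ε := 9 / 10) (θ := 999 / 1000)
    (by norm_num) (by norm_num) (by norm_num) (by norm_num)
    fun p q => BanachGeometry.norm_add_le_of_le_norm_sub hc
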